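/- \textbf{Notation.} Write $\mathbb{C}^n_{0,0}$ for the set of $v=(v_0,\dots,v_{n-1})\in\mathbb{C}^n$ with $v_0\ne0\ne v_{n-1}$. For $v\in\mathbb{C}^n$ let $\overline{v^-}$ denote the conjugate time reversal, $(\overline{v^-})_k=\overline{v_{n-1-k}}$, let $V(z)=\sum_k v_kz^{-k}$ be the $z$-transform, and let $a_v=v*\overline{v^-}\in\mathbb{C}^{2n-1}$ be the autocorrelation, where $*$ is aperiodic convolution. A sequence $x\in\mathbb{C}^L_{0,0}$, $L\ge2$, is a \emph{Huffman sequence with main lobe $E\in\mathbb{R}$} if $a_x=(-1,0_{L-2},E,0_{L-2},-1)$. For $x_1\in\mathbb{C}^{L_1}$, $x_2\in\mathbb{C}^{L_2}$, $N=L_1+L_2$, let $\mathcal{A}$ be the linear map on $\mathbb{C}^{N\times N}$, viewed as $2\times2$ block matrices $X=(X_{ij})$, given by $\mathcal{A}(X)=(\mathcal A_{11}(X),\mathcal A_{22}(X),\mathcal A_{12}(X),\mathcal A_{21}(X))$ with $(\mathcal{A}_{ij}(X))_k=\sum_{m-n=k-L_j+1}(X_{ij})_{m,n}$ for $0\le k\le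 L_i+L_j-2$, so that $\mathcal{A}_{ij}(vv^*)=v_i*\overline{v_j^-}$ for stacked vectors $v=(v_1,v_2)$. The \emph{program with data $b$} is: find $X\in\mathbb{C}^{N\times N}$ with $\mathcal{A}(X)=b$ and $X\succeq0$. For even $L$, $E\ge2$ and bits $b\in\{0,1\}^{L-1}$, the \emph{Huffman codeword} is the $x\in\mathbb{C}^L$ with $$X(z)=-c^{-1}\prod_{k:\,b_k=1}\bigl(z^{-1}-\overline{\zeta_k^-}\bigr)\prod_{k:\,b_k=0}\bigl(z^{-1}-\overline{\zeta_k^+}\bigr),\qquad \zeta_k^\pm=e^{-2\pi i\frac{k-1}{L-1}}R_\pm,\quad R_\pm=\Bigl(\tfrac E2\pm\sqrt{\tfrac{E^2}4-1}\Bigr)^{\frac1{L-1}},$$ $k=1,\dots,L-1$, where $c>0$ and $c^2=R_+^{\#\{k:b_k=0\}-\#\{k:b_k=1\}}$. \textbf{Theorem.} Let $K\ge1$, $M\ge0$, $L=2K+M$, let $h\in\mathbb{C}^K_{0,0}$ (the channel). (A) Let $x\in\mathbb{C}^L_{0,0}$ be a Huffman sequence with main lobe $E$, and $y=x*h\in\mathbb{C}^{L+K-1}$.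 Then: 1. $a_y=(-a_h,\,0_M,\,E\,a_h,\,0_M,\,-a_h)$. Consequently, if $a_{y,1}$ and $a_{y,3}$ denote the first and the third of these five blocks of $a_y$ (each of length $2K-1$), then $a_{y,1}\ne0$, $a_h=-a_{y,1}$ and $E=\|a_{y,3}\|_2/\|a_{y,1}\|_2$; moreover $E=\|x\|_2^2$. Hence $a_x=(-1,0_{L-2},E,0_{L-2},-1)$ and $a_h$ are determined exactly by $y$. 2. Suppose that $X(z)$ and the $z$-transform $H^*(z)$ of $\overline{h^-}$ have no common factor (as polynomials in $z^{-1}$). Then the program (with $L_1=L$, $L_2=K$) with data $(a_x,a_h,y,\overline{y^-})$, where $a_x$ and $a_h$ are computed from $y$ as in 1, has the unique solution $X^\#=ww^*$ with $w=(x,\overline{h^-})$. A vector $x^\#\in\mathbb{C}^{L+K}$ satisfies $x^\#(x^\#)^*=X^\#$ if and only if $x^\#=e^{i\phi}w$ for some $\phi\in\mathbb{R}$. 3. If in addition $x_0>0$, then for every such $x^\#$ one has $x^\#/(x_0^\#/|x_0^\#|)=(x,\overline{h^-})$; thus $x$ and $h$ are recovered exactly. (B) If $L$ is even and $E\ge2$,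 then every Huffman codeword of length $L$ for $E$ is a Huffman sequence with main lobe $E$ and satisfies $x_0>0$. So, if it satisfies the coprimality condition in (A.2), the codeword $x$, the channel $h$ and the energy $E$ are all recovered exactly from $y$. -/

import Mathlib

open Polynomial
open scoped ComplexOrder

noncomputable section

namespace HuffmanBlind

/-- Both the first and the last coefficient of the (nonempty) vector `x` are nonzero. -/
def EndsNonzero {L : ℕ} (x : Fin L → ℂ) : Prop :=
  ∃ hL : 0 < L, x ⟨0, hL⟩ ≠ 0 ∧ x ⟨L - 1, Nat.sub_lt hL Nat.one_pos⟩ ≠ 0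

/-- The aperiodic convolution, `(x * h) k = ∑_{i + j = k} x i * h j`, of length `L + K - 1`. -/
def seqConv {L K : ℕ} (x : Fin L → ℂ) (h : Fin K → ℂ) : Fin (L + K - 1) → ℂ :=
  fun k => ∑ i : Fin L, ∑ j : Fin K, if (i : ℕ) + (j : ℕ) = (k : ℕ) then x i * h j else 0

/-- The conjugate time reversal, with `k`-th coefficient `star (x (L - 1 - k))`. -/
def conjRev {L : ℕ} (x : Fin L → ℂ) : Fin L → ℂ := fun k => star (x (Fin.rev k))

/-- The aperiodic autocorrelation, of length `2 L - 1`. -/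
def autocorr {L : ℕ} (x : Fin L → ℂ) : Fin (L + L - 1) → ℂ := seqConv x (conjRev x)

/-- The z-transform, a polynomial in the variable `z⁻¹` (here written `X`). -/
def zTransform {L : ℕ} (x : Fin L → ℂ) : ℂ[X] := ∑ k : Fin L, C (x k) * X ^ (k : ℕ)

/-! ### Huffman sequences -/

/-- The vector `(-1, 0, …, 0, E, 0, …, 0, -1)` of length `2 L - 1` (used for `L ≥ 2`). -/
def huffmanAutocorr (L : ℕ) (E : ℝ) : Fin (L + L - 1) → ℂ := fun k =>
  if (k : ℕ) = 0 ∨ (k : ℕ) + 2 = 2 * L then -1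
  else if (k : ℕ) + 1 = L then (E : ℂ)
  else 0

/-- `x` is a Huffman sequence (with main lobe `E`): its autocorrelation is
`(-1, 0, …, 0, E, 0, …, 0, -1)`. -/
def IsHuffman {L : ℕ} (E : ℝ) (x : Fin L → ℂ) : Prop :=
  EndsNonzero x ∧ autocorr x = huffmanAutocorr L E

/-- The outer radius `R₊ = (E/2 + √(E²/4 - 1)) ^ (1/(L-1))`. -/
def radiusPlus (L : ℕ) (E : ℝ) : ℝ := (E / 2 + √(E ^ 2 / 4 - 1)) ^ (1 / ((L : ℝ) - 1))

/-- The inner radius `R₋ = (E/2 - √(E²/4 - 1)) ^ (1/(L-1))`. -/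
def radiusMinus (L : ℕ) (E : ℝ) : ℝ := (E / 2 - √(E ^ 2 / 4 - 1)) ^ (1 / ((L : ℝ) - 1))

/-- The root of unity `exp(-2πi k/(L-1))`, `k = 0, …, L-2`. -/
def huffmanAngle (L : ℕ) (k : Fin (L - 1)) : ℂ :=
  Complex.exp (-(2 * Real.pi * Complex.I * ((k : ℕ) : ℂ) / ((L : ℂ) - 1)))

/-- The zeros `ζₖ⁺` on the outer circle. -/
def zetaPlus (L : ℕ) (E : ℝ) (k : Fin (L - 1)) : ℂ := huffmanAngle L k * (radiusPlus L E : ℂ)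

/-- The zeros `ζₖ⁻` on the inner circle. -/
def zetaMinus (L : ℕ) (E : ℝ) (k : Fin (L - 1)) : ℂ := huffmanAngle L k * (radiusMinus L E : ℂ)

/-- The positive number `c` with `c² = R₊ ^ (|B₋| - |B₊|)`, where `B₊` (resp. `B₋`) is the set of
positions of the bits that are one (resp. zero). -/
def codewordScale (L : ℕ) (E : ℝ) (b : Fin (L - 1) → Bool) : ℝ :=
  √(radiusPlus L E ^
    (((Finset.univ.filter fun k => b k = false).card : ℤ)
      - ((Finset.univ.filter fun k => b k = true).card : ℤ)))

/-- The z-transform of the codeword that encodes the bits `b`, as a polynomial in `X = z⁻¹`: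
`-c⁻¹ ∏_{k ∈ B₊} (z⁻¹ - conj ζₖ⁻) ∏_{k ∈ B₋} (z⁻¹ - conj ζₖ⁺)`.
Since `1 / conj ζₖ⁻ = ζₖ⁺`, its zeros in `z` are `ζₖ⁺` for `k ∈ B₊` and `ζₖ⁻` for `k ∈ B₋`. -/
def codewordPoly (L : ℕ) (E : ℝ) (b : Fin (L - 1) → Bool) : ℂ[X] :=
  C (-((codewordScale L E b : ℂ))⁻¹) *
    ∏ k : Fin (L - 1), (X - C (star (if b k = true then zetaMinus L E k else zetaPlus L E k)))

/-- The Huffman codeword of length `L` and energy `E` that encodes the bits `b`. -/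
def huffmanCodeword (L : ℕ) (E : ℝ) (b : Fin (L - 1) → Bool) : Fin L → ℂ :=
  fun k => (codewordPoly L E b).coeff (k : ℕ)

/-! ### Reading off channel autocorrelation and energy from the received signal -/

/-- The block of `m` consecutive entries of `v` starting at position `s`. -/
def block {n : ℕ} (s m : ℕ) (v : Fin n → ℂ) : Fin m → ℂ :=
  fun i => if hi : s + (i : ℕ) < n then v ⟨s + (i : ℕ), hi⟩ else 0

/-- The first block of the autocorrelation of `y`, of length `2 K - 1`. -/
def firstBlock (K : ℕ) {n : ℕ} (y : Fin n → ℂ) : Fin (K + K - 1) → ℂ :=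
  block 0 (K + K - 1) (autocorr y)

/-- The third (middle) block of the autocorrelation of `y`, of length `2 K - 1`. -/
def thirdBlock (K M : ℕ) {n : ℕ} (y : Fin n → ℂ) : Fin (K + K - 1) → ℂ :=
  block (K + K - 1 + M) (K + K - 1) (autocorr y)

/-- The Euclidean norm of a vector. -/
def norm2 {n : ℕ} (v : Fin n → ℂ) : ℝ := ‖WithLp.toLp 2 v‖

/-- The channel autocorrelation as read off by the receiver. -/
def channelAutocorrEst (K : ℕ) {n : ℕ} (y : Fin n → ℂ) : Fin (K + K - 1) → ℂ :=
  -firstBlock K y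

/-- The energy as computed by the receiver. -/
def energyEst (K M : ℕ) {n : ℕ} (y : Fin n → ℂ) : ℝ :=
  norm2 (thirdBlock K M y) / norm2 (firstBlock K y)

/-! ### The semidefinite program -/

/-- The `L₂ × L₁` shift matrix `T⁽ᵏ⁾`: its `(n, m)` entry is one if `m - n = k - L₂ + 1` and zero
otherwise, so that `tr (T⁽ᵏ⁾ u vᴴ)` is the `k`-th coefficient of the convolution of `u` with the
conjugate time reversal of `v`. -/
def shiftMatrix (L₁ L₂ k : ℕ) : Matrix (Fin L₂) (Fin L₁) ℂ :=
  Matrix.of fun n m => if (m : ℕ) + L₂ = k + (n : ℕ) + 1 then 1 else 0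

/-- The correlation measurements `(a₁₁, a₂₂, a₁₂, a₂₁)`. -/
abbrev Measurements (L₁ L₂ : ℕ) : Type :=
  (Fin (L₁ + L₁ - 1) → ℂ) × (Fin (L₂ + L₂ - 1) → ℂ) ×
    (Fin (L₁ + L₂ - 1) → ℂ) × (Fin (L₁ + L₂ - 1) → ℂ)

/-- The linear measurement map on `N × N` matrices, `N = L₁ + L₂`, written in block form. -/
def measure {L₁ L₂ : ℕ} (Z : Matrix (Fin L₁ ⊕ Fin L₂) (Fin L₁ ⊕ Fin L₂) ℂ) :
    Measurements L₁ L₂ :=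
  (fun k => (shiftMatrix L₁ L₁ k * Z.toBlocks₁₁).trace,
   fun k => (shiftMatrix L₂ L₂ k * Z.toBlocks₂₂).trace,
   fun k => (shiftMatrix L₁ L₂ k * Z.toBlocks₁₂).trace,
   fun k => (shiftMatrix L₂ L₁ k * Z.toBlocks₂₁).trace)

/-- `Z` solves the semidefinite feasibility program with data `b`. -/
def SolvesSDP {L₁ L₂ : ℕ} (b : Measurements L₁ L₂)
    (Z : Matrix (Fin L₁ ⊕ Fin L₂) (Fin L₁ ⊕ Fin L₂) ℂ) : Prop :=
  measure Z = b ∧ Z.PosSemidef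

/-- The rank one matrix `v vᴴ`. -/
def rankOne {ι : Type*} (v : ι → ℂ) : Matrix ι ι ℂ := Matrix.vecMulVec v (star v)

/-- The data that the receiver inserts into the program; they depend on `y` (and on the lengths)
only. -/
def receiverData (K M L : ℕ) (y : Fin (L + K - 1) → ℂ) : Measurements L K :=
  (huffmanAutocorr L (energyEst K M y), channelAutocorrEst K y, y, conjRev y)

/-! ### Removing the global phase -/

/-- The phase of the first coefficient of a stacked vector. -/
def firstPhase {L K : ℕ} (hL : 0 < L) (v : Fin L ⊕ Fin K → ℂ) : ℂ :=
  v (Sum.inl ⟨0, hL⟩) / (‖v (Sum.inl ⟨0, hL⟩)‖ : ℂ)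

/-- The data sequence obtained from a stacked vector after division by the phase of its first
coefficient. -/
def recoveredData {L K : ℕ} (hL : 0 < L) (v : Fin L ⊕ Fin K → ℂ) : Fin L → ℂ :=
  fun i => v (Sum.inl i) / firstPhase hL v

/-- The channel obtained from a stacked vector after division by the phase of its first
coefficient. -/
def recoveredChannel {L K : ℕ} (hL : 0 < L) (v : Fin L ⊕ Fin K → ℂ) : Fin K → ℂ :=
  conjRev fun j => v (Sum.inr j) / firstPhase hL v

end HuffmanBlind

end

open HuffmanBlind

namespace HuffmanBlind

/-! The z-transform turns convolution into multiplication; write P~ for the transform of the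
conjugate time reversal of p. For y = x * h this gives Y Y~ = (X X~)(H H~), and the Huffman
condition makes X X~ = -1 + E z^(-(L-1)) - z^(-2(L-1)). As L - 1 = (2K - 1) + M, the three shifted
copies of a_h do not overlap and can be read off.

Uniqueness needs no dual certificate. A feasible Z is a sum of rank-one matrices of stacked vectors
(p_l, q_l). With g the conjugate reversal of h, consider the residuals r_l = p_l * g - x * q_l. The
sum of their autocorrelations involves the p_l, q_l only through the four sums fixed by the data, so
it is the same as for (x, g), namely 0. Its central coefficient is the sum of the ‖r_l‖², hence P_l
G = X Q_l for every l. Coprimality and the degree bound force (p_l, q_l) = c_l (x, g)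
(`exists_smul_of_mul_eq`), and the norm of x gives ∑ |c_l|² = 1 (`eq_rankOne_of_solvesSDP`).

For a codeword, each zero of X is paired in X X~ with its reflection in the unit circle. Every ray
thus contributes both radii whatever its bit (`X_sub_C_mul_one_sub`), and the product over all rays
is (z^(-n) - R₊^n)(z^(-n) - R₋^n), n = L - 1, up to a constant. -/

/-! ### Convolution and conjugate reversal in terms of polynomials -/

lemma coeff_zTransform {L : ℕ} (x : Fin L → ℂ) (k : ℕ) :
    (zTransform x).coeff k = if hk : k < L then x ⟨k, hk⟩ else 0 := by
  simp only [zTransform, finsetSum_coeff, coeff_C_mul, coeff_X_pow, mul_ite, mul_one, mul_zero]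
  split_ifs with hk
  · rw [Finset.sum_eq_single ⟨k, hk⟩]
    · simp
    · intro b _ hb
      rw [if_neg]
      rintro rfl
      exact hb rfl
    · simp
  · refine Finset.sum_eq_zero fun i _ => if_neg ?_
    have := i.2
    omega

lemma coeff_zTransform_fin {L : ℕ} (x : Fin L → ℂ) (k : Fin L) :
    (zTransform x).coeff k = x k := by
  simp [coeff_zTransform]

lemma zTransform_injective {L : ℕ} : Function.Injective (zTransform (L := L)) := by
  intro x y hxy
  ext k
  rw [← coeff_zTransform_fin x, hxy, coeff_zTransform_fin]

lemma degree_zTransform_lt {L : ℕ} (x : Fin L → ℂ) : (zTransform x).degree < L := by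
  rw [degree_lt_iff_coeff_zero]
  intro m hm
  rw [coeff_zTransform, dif_neg (by omega)]

lemma zTransform_coeff_eq {L : ℕ} {p : ℂ[X]} (hp : p.degree < L) :
    zTransform (fun k : Fin L => p.coeff k) = p := by
  ext k
  rw [coeff_zTransform]
  split_ifs with hk
  · rfl
  · exact ((degree_lt_iff_coeff_zero p L).1 hp k (by omega)).symm

lemma zTransform_sub {L : ℕ} (x y : Fin L → ℂ) :
    zTransform (x - y) = zTransform x - zTransform y := by
  simp [zTransform, sub_mul]

lemma conjRev_sub {L : ℕ} (x y : Fin L → ℂ) : conjRev (x - y) = conjRev x - conjRev y := by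
  ext k
  simp [conjRev]

lemma conjRev_conjRev {L : ℕ} (x : Fin L → ℂ) : conjRev (conjRev x) = x := by
  ext k
  simp [conjRev]

lemma coeff_zTransform_mul {L K : ℕ} (x : Fin L → ℂ) (h : Fin K → ℂ) (k : ℕ) :
    (zTransform x * zTransform h).coeff k =
      ∑ i : Fin L, ∑ j : Fin K, if (i : ℕ) + (j : ℕ) = k then x i * h j else 0 := by
  have hmul : zTransform x * zTransform h =
      ∑ i : Fin L, ∑ j : Fin K, C (x i * h j) * X ^ ((i : ℕ) + (j : ℕ)) := by
    rw [zTransform, zTransform, Finset.sum_mul_sum]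
    refine Finset.sum_congr rfl fun i _ => Finset.sum_congr rfl fun j _ => ?_
    rw [C_mul, pow_add]
    ring
  simp only [hmul, finsetSum_coeff, coeff_C_mul, coeff_X_pow, mul_ite, mul_one, mul_zero]
  simp only [eq_comm]

lemma coeff_zTransform_mul_eq_zero {L K : ℕ} (x : Fin L → ℂ) (h : Fin K → ℂ) {k : ℕ}
    (hk : L + K - 1 ≤ k) : (zTransform x * zTransform h).coeff k = 0 := by
  rw [coeff_zTransform_mul]
  refine Finset.sum_eq_zero fun i _ => Finset.sum_eq_zero fun j _ => if_neg ?_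
  have := i.2
  have := j.2
  omega

lemma seqConv_apply {L K : ℕ} (x : Fin L → ℂ) (h : Fin K → ℂ) (k : Fin (L + K - 1)) :
    seqConv x h k = (zTransform x * zTransform h).coeff k :=
  (coeff_zTransform_mul x h k).symm

lemma zTransform_seqConv {L K : ℕ} (x : Fin L → ℂ) (h : Fin K → ℂ) :
    zTransform (seqConv x h) = zTransform x * zTransform h := by
  ext k
  rw [coeff_zTransform]
  split_ifs with hk
  · rw [seqConv_apply]
  · rw [coeff_zTransform_mul_eq_zero x h (by omega)]

lemma conjRev_seqConv {L K : ℕ} (x : Fin L → ℂ) (h : Fin K → ℂ) :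
    conjRev (seqConv x h) = seqConv (conjRev x) (conjRev h) := by
  ext k
  simp only [conjRev, seqConv, star_sum]
  refine Fintype.sum_equiv Fin.revPerm _ _ fun i => Fintype.sum_equiv Fin.revPerm _ _ fun j => ?_
  have hi := i.2
  have hj := j.2
  have hk := k.2
  simp only [Fin.revPerm_apply, Fin.rev_rev, Fin.val_rev, apply_ite star, star_mul', star_zero]
  congr 1
  simp only [eq_iff_iff]
  omega

lemma zTransform_autocorr_seqConv {L K : ℕ} (x : Fin L → ℂ) (h : Fin K → ℂ) :
    zTransform (autocorr (seqConv x h)) =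
      zTransform (autocorr x) * zTransform (autocorr h) := by
  simp only [autocorr, conjRev_seqConv, zTransform_seqConv]
  ring

/-! ### The central autocorrelation coefficient and the Euclidean norm -/

lemma coeff_zTransform_mul_conjRev_pred {L : ℕ} (x : Fin L → ℂ) :
    (zTransform x * zTransform (conjRev x)).coeff (L - 1) = ∑ i, x i * star (x i) := by
  rw [coeff_zTransform_mul]
  refine Finset.sum_congr rfl fun i _ => ?_
  rw [Finset.sum_eq_single (Fin.rev i)]
  · rw [if_pos]
    · simp [conjRev]
    · rw [Fin.val_rev]
      omega
  · intro j _ hj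
    rw [if_neg]
    intro hij
    apply hj
    ext
    rw [Fin.val_rev]
    omega
  · simp

lemma mul_star_eq_normSq (z : ℂ) : z * star z = ((‖z‖ ^ 2 : ℝ) : ℂ) := by
  rw [Complex.star_def, Complex.mul_conj, Complex.normSq_eq_norm_sq]

lemma norm2_sq {n : ℕ} (v : Fin n → ℂ) : norm2 v ^ 2 = ∑ i, ‖v i‖ ^ 2 := by
  simp [norm2, EuclideanSpace.norm_sq_eq]

lemma coeff_autocorr_center {L : ℕ} (x : Fin L → ℂ) :
    (zTransform x * zTransform (conjRev x)).coeff (L - 1) = ((norm2 x ^ 2 : ℝ) : ℂ) := by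
  rw [coeff_zTransform_mul_conjRev_pred, norm2_sq, Complex.ofReal_sum]
  exact Finset.sum_congr rfl fun i _ => mul_star_eq_normSq _

lemma norm2_eq_zero {n : ℕ} {v : Fin n → ℂ} : norm2 v = 0 ↔ v = 0 := by
  simp [norm2]

lemma norm2_neg {n : ℕ} (v : Fin n → ℂ) : norm2 (-v) = norm2 v := by
  simp [norm2]

lemma norm2_smul {n : ℕ} (c : ℂ) (v : Fin n → ℂ) : norm2 (c • v) = ‖c‖ * norm2 v := by
  simp [norm2, norm_smul]

/-- If the autocorrelations of finitely many sequences add up to zero, all sequences vanish. -/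
lemma eq_zero_of_sum_autocorr_eq_zero {ι : Type*} [Fintype ι] {L : ℕ} (r : ι → Fin L → ℂ)
    (hr : ∑ l, zTransform (r l) * zTransform (conjRev (r l)) = 0) (l : ι) : r l = 0 := by
  have h1 : (∑ l, norm2 (r l) ^ 2) = 0 := by
    -- The central coefficient of each autocorrelation is a squared norm, so nonnegative terms add
    -- up to 0.
    have := congrArg (fun p => p.coeff (L - 1)) hr
    simp only [finsetSum_coeff, coeff_autocorr_center, coeff_zero] at this
    exact_mod_cast this
  have h2 := (Finset.sum_eq_zero_iff_of_nonneg fun l _ => sq_nonneg (norm2 (r l))).1 h1 l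
    (Finset.mem_univ l)
  exact norm2_eq_zero.1 (pow_eq_zero_iff two_ne_zero |>.1 h2)

/-- Keeps the denominator in `energyEst` away from 0. -/
lemma norm2_autocorr_ne_zero {K : ℕ} {h : Fin K → ℂ} (hh : EndsNonzero h) :
    norm2 (autocorr h) ≠ 0 := by
  obtain ⟨hK, h0, -⟩ := hh
  rw [Ne, norm2_eq_zero]
  intro ha
  have := eq_zero_of_sum_autocorr_eq_zero (fun _ : Unit => h) (by
    rw [Finset.univ_unique, Finset.sum_singleton, ← zTransform_seqConv]
    change zTransform (autocorr h) = 0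
    rw [ha]
    simp [zTransform]) ()
  exact h0 (congrFun this _)

/-! ### The autocorrelation of the received signal -/

lemma zTransform_huffmanAutocorr {L : ℕ} (hL : 2 ≤ L) (E : ℝ) :
    zTransform (huffmanAutocorr L E) = -1 + C (E : ℂ) * X ^ (L - 1) - X ^ (2 * (L - 1)) := by
  ext k
  simp only [coeff_zTransform, huffmanAutocorr, coeff_sub, coeff_add, coeff_neg, coeff_one,
    coeff_C_mul, coeff_X_pow]
  split_ifs <;> first | omega | simp

lemma zTransform_autocorr_received {K L : ℕ} (hL : 2 ≤ L) (h : Fin K → ℂ) {E : ℝ}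
    {x : Fin L → ℂ} (hx : IsHuffman E x) :
    zTransform (autocorr (seqConv x h)) =
      -zTransform (autocorr h) + C (E : ℂ) * (zTransform (autocorr h) * X ^ (L - 1))
        - zTransform (autocorr h) * X ^ (2 * (L - 1)) := by
  rw [zTransform_autocorr_seqConv, hx.2, zTransform_huffmanAutocorr hL]
  ring

lemma coeff_autocorr_received {K L : ℕ} (hL : 2 ≤ L) (h : Fin K → ℂ) {E : ℝ}
    {x : Fin L → ℂ} (hx : IsHuffman E x) (k : ℕ) :
    (zTransform (autocorr (seqConv x h))).coeff k =
      -(zTransform (autocorr h)).coeff k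
        + E * (if L - 1 ≤ k then (zTransform (autocorr h)).coeff (k - (L - 1)) else 0)
        - (if 2 * (L - 1) ≤ k then (zTransform (autocorr h)).coeff (k - 2 * (L - 1)) else 0) := by
  rw [zTransform_autocorr_received hL h hx]
  simp only [coeff_sub, coeff_add, coeff_neg, coeff_C_mul, coeff_mul_X_pow']

lemma autocorr_received_eq {K M L : ℕ} (hK : 1 ≤ K) (hL : L = 2 * K + M) (h : Fin K → ℂ) {E : ℝ}
    {x : Fin L → ℂ} (hx : IsHuffman E x) :
    List.ofFn (autocorr (seqConv x h)) =
          List.ofFn (-autocorr h) ++ List.replicate M 0 ++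
          List.ofFn ((E : ℂ) • autocorr h) ++ List.replicate M 0 ++
          List.ofFn (-autocorr h) := by
  refine List.ext_getElem ?_ fun k h1 h2 => ?_
  · simp only [List.length_append, List.length_ofFn, List.length_replicate]
    omega
  · rw [List.length_ofFn] at h1
    rw [List.getElem_ofFn, ← coeff_zTransform_fin (autocorr (seqConv x h)),
      coeff_autocorr_received (by omega) h hx]
    simp only [List.getElem_append, List.length_append, List.length_ofFn, List.length_replicate,
      List.getElem_ofFn, List.getElem_replicate, coeff_zTransform, Pi.neg_apply, Pi.smul_apply,
      smul_eq_mul]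
    -- At most one of the three copies of a_h is nonzero at a given index, because 2K - 1 ≤ L - 1;
    -- `omega` removes the incompatible cases.
    split_ifs <;> first
      | omega
      | (simp only [neg_zero, mul_zero, zero_add, add_zero, zero_sub, sub_zero]; done)
      | (simp only [neg_zero, mul_zero, zero_add, add_zero, zero_sub, sub_zero]
         congr 2
         rw [Fin.mk.injEq]
         omega)

/-- The default 0 of `block` beyond the end agrees with the vanishing of high coefficients. -/
lemma block_apply_eq_coeff {n s m : ℕ} (v : Fin n → ℂ) (i : Fin m) :
    block s m v i = (zTransform v).coeff (s + i) := by
  rw [coeff_zTransform, block]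

lemma firstBlock_received {K M L : ℕ} (hK : 1 ≤ K) (hL : L = 2 * K + M) (h : Fin K → ℂ) {E : ℝ}
    {x : Fin L → ℂ} (hx : IsHuffman E x) :
    firstBlock K (seqConv x h) = -autocorr h := by
  ext i
  have hi := i.2
  rw [firstBlock, block_apply_eq_coeff, coeff_autocorr_received (by omega) h hx,
    if_neg (by omega), if_neg (by omega), zero_add, coeff_zTransform_fin]
  simp

lemma thirdBlock_received {K M L : ℕ} (hK : 1 ≤ K) (hL : L = 2 * K + M) (h : Fin K → ℂ) {E : ℝ}
    {x : Fin L → ℂ} (hx : IsHuffman E x) :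
    thirdBlock K M (seqConv x h) = (E : ℂ) • autocorr h := by
  ext i
  have hi := i.2
  rw [thirdBlock, block_apply_eq_coeff, coeff_autocorr_received (by omega) h hx,
    if_pos (by omega), if_neg (by omega), coeff_zTransform, dif_neg (by omega),
    show K + K - 1 + M + (i : ℕ) - (L - 1) = i by omega, coeff_zTransform_fin]
  simp

lemma energy_eq_norm2_sq {L : ℕ} (hL : 2 ≤ L) {E : ℝ} {x : Fin L → ℂ} (hx : IsHuffman E x) :
    E = norm2 x ^ 2 := by
  have h1 := coeff_autocorr_center x
  rw [← zTransform_seqConv] at h1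
  change (zTransform (autocorr x)).coeff (L - 1) = _ at h1
  rw [hx.2, zTransform_huffmanAutocorr hL] at h1
  simp only [coeff_sub, coeff_add, coeff_neg, coeff_one, coeff_C_mul, coeff_X_pow] at h1
  rw [if_neg (by omega), if_pos trivial, if_neg (by omega)] at h1
  simp only [neg_zero, mul_one, zero_add, sub_zero] at h1
  exact_mod_cast h1

lemma energyEst_received {K M L : ℕ} (hK : 1 ≤ K) (hL : L = 2 * K + M) {h : Fin K → ℂ}
    (hh : EndsNonzero h) {E : ℝ} {x : Fin L → ℂ} (hx : IsHuffman E x) :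
    energyEst K M (seqConv x h) = E := by
  -- The quotient of norms only yields |E|; the sign comes from E being a squared norm.
  have hE : 0 ≤ E := by
    rw [energy_eq_norm2_sq (by omega) hx]
    positivity
  rw [energyEst, firstBlock_received hK hL h hx, thirdBlock_received hK hL h hx, norm2_neg,
    norm2_smul, mul_div_cancel_right₀ _ (norm2_autocorr_ne_zero hh), Complex.norm_real,
    Real.norm_of_nonneg hE]

lemma receiverData_received {K M L : ℕ} (hK : 1 ≤ K) (hL : L = 2 * K + M) {h : Fin K → ℂ}
    (hh : EndsNonzero h) {E : ℝ} {x : Fin L → ℂ} (hx : IsHuffman E x) :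
    receiverData K M L (seqConv x h) =
      (autocorr x, autocorr h, seqConv x h, conjRev (seqConv x h)) := by
  rw [receiverData, energyEst_received hK hL hh hx, hx.2, channelAutocorrEst,
    firstBlock_received hK hL h hx, neg_neg]

/-! ### The semidefinite program -/

/-- The condition m + L₂ = k + n + 1 says m + (L₂ - 1 - n) = k, so reversing n turns the trace into
a convolution sum. -/
lemma trace_shiftMatrix_mul_vecMulVec {L₁ L₂ : ℕ} (k : ℕ) (p : Fin L₁ → ℂ) (q : Fin L₂ → ℂ) :
    (shiftMatrix L₁ L₂ k * Matrix.vecMulVec p (star q)).trace =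
      (zTransform p * zTransform (conjRev q)).coeff k := by
  rw [coeff_zTransform_mul, Matrix.trace, Finset.sum_comm]
  refine Fintype.sum_equiv Fin.revPerm _ _ fun n => ?_
  rw [Matrix.diag_apply, Matrix.mul_apply]
  refine Finset.sum_congr rfl fun m _ => ?_
  have := n.2
  have := m.2
  simp only [shiftMatrix, Matrix.of_apply, Matrix.vecMulVec_apply, Pi.star_apply, ite_mul, one_mul,
    zero_mul, Fin.revPerm_apply, Fin.val_rev, conjRev, Fin.rev_rev]
  congr 1
  simp only [eq_iff_iff]
  omega

lemma solvesSDP_rankOne {L K : ℕ} (p : Fin L → ℂ) (q : Fin K → ℂ) :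
    SolvesSDP (autocorr p, autocorr q, seqConv p (conjRev q), conjRev (seqConv p (conjRev q)))
      (rankOne (Sum.elim p q)) := by
  refine ⟨?_, Matrix.posSemidef_vecMulVec_self_star _⟩
  rw [conjRev_seqConv, conjRev_conjRev]
  simp only [measure, Prod.mk.injEq]
  refine ⟨?_, ?_, ?_, ?_⟩ <;> ext k
  · rw [autocorr, seqConv_apply, ← trace_shiftMatrix_mul_vecMulVec]
    rfl
  · rw [autocorr, seqConv_apply, ← trace_shiftMatrix_mul_vecMulVec]
    rfl
  · rw [seqConv_apply, ← trace_shiftMatrix_mul_vecMulVec]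
    rfl
  · rw [seqConv_apply, mul_comm, ← trace_shiftMatrix_mul_vecMulVec]
    rfl

lemma trace_shiftMatrix_mul_sum {ι : Type*} [Fintype ι] {L₁ L₂ : ℕ} (k : ℕ)
    (p : ι → Fin L₁ → ℂ) (q : ι → Fin L₂ → ℂ) :
    (shiftMatrix L₁ L₂ k * ∑ l, Matrix.vecMulVec (p l) (star (q l))).trace =
      (∑ l, zTransform (p l) * zTransform (conjRev (q l))).coeff k := by
  simp only [Matrix.mul_sum, Matrix.trace_sum, finsetSum_coeff, trace_shiftMatrix_mul_vecMulVec]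

/-- The separate length n serves the (2,1) block, whose data have index type `Fin (L + K - 1)`
rather than `Fin (K + L - 1)`. -/
lemma sum_zTransform_eq {ι : Type*} [Fintype ι] {L₁ L₂ n : ℕ} (hn : L₁ + L₂ - 1 ≤ n)
    {p : ι → Fin L₁ → ℂ} {q : ι → Fin L₂ → ℂ} {P : Fin L₁ → ℂ} {Q : Fin L₂ → ℂ}
    (hpq : ∀ k : Fin n,
      (∑ l, zTransform (p l) * zTransform (conjRev (q l))).coeff k =
        (zTransform P * zTransform (conjRev Q)).coeff k) :
    ∑ l, zTransform (p l) * zTransform (conjRev (q l)) =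
      zTransform P * zTransform (conjRev Q) := by
  ext k
  by_cases hk : k < n
  · exact hpq ⟨k, hk⟩
  · rw [finsetSum_coeff, coeff_zTransform_mul_eq_zero P _ (by omega)]
    exact Finset.sum_eq_zero fun l _ => coeff_zTransform_mul_eq_zero _ _ (by omega)

/-- A pair of polynomials with the same ratio as a coprime pair, the first of maximal degree, is a
scalar multiple of that pair. -/
lemma exists_smul_of_mul_eq {L K : ℕ} {p x : Fin L → ℂ} {q g : Fin K → ℂ} (hx : EndsNonzero x)
    (hc : IsCoprime (zTransform x) (zTransform g))
    (he : zTransform p * zTransform g = zTransform x * zTransform q) :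
    ∃ c : ℂ, p = c • x ∧ q = c • g := by
  obtain ⟨hL, -, h1⟩ := hx
  have hdeg : ((L - 1 : ℕ) : WithBot ℕ) ≤ (zTransform x).degree := by
    apply le_degree_of_ne_zero
    rwa [coeff_zTransform, dif_pos (by omega)]
  have hx0 : zTransform x ≠ 0 := by
    rintro h0
    simp [h0] at hdeg
  obtain ⟨u, hu⟩ : zTransform x ∣ zTransform p :=
    hc.dvd_of_dvd_mul_right ⟨_, he⟩
  -- The last entry of x is nonzero, so X has degree L - 1, which P cannot exceed: the quotient is
  -- constant.
  have hu0 : u.degree ≤ 0 := by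
    by_cases hu0 : u = 0
    · simp [hu0]
    have hp := degree_zTransform_lt p
    rw [hu, degree_mul, degree_eq_natDegree hx0, degree_eq_natDegree hu0] at hp
    rw [degree_eq_natDegree hx0] at hdeg
    rw [degree_eq_natDegree hu0]
    norm_cast at hp hdeg ⊢
    omega
  rw [eq_C_of_degree_le_zero hu0] at hu
  have hsmul : ∀ {n : ℕ} (c : ℂ) (v : Fin n → ℂ), zTransform (c • v) = zTransform v * C c := by
    intro n c v
    ext k
    simp only [coeff_zTransform, coeff_mul_C]
    split_ifs <;> simp [mul_comm]
  refine ⟨u.coeff 0, zTransform_injective ?_, zTransform_injective ?_⟩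
  · rw [hu, hsmul]
  · rw [hsmul]
    refine mul_left_cancel₀ hx0 ?_
    rw [← he, hu]
    ring

/-- Each rank-one summand of a feasible matrix has zero residual p_l * g - x * q_l, hence is
proportional to the expected one. -/
lemma eq_rankOne_of_solvesSDP {L K : ℕ} {x : Fin L → ℂ} {g : Fin K → ℂ} (hx : EndsNonzero x)
    (hc : IsCoprime (zTransform x) (zTransform g))
    {Z : Matrix (Fin L ⊕ Fin K) (Fin L ⊕ Fin K) ℂ}
    (hZ : SolvesSDP (autocorr x, autocorr g, seqConv x (conjRev g),
      conjRev (seqConv x (conjRev g))) Z) :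
    Z = rankOne (Sum.elim x g) := by
  obtain ⟨hm, hpos⟩ := hZ
  obtain ⟨B, rfl⟩ : ∃ B, Z = B.conjTranspose * B := by
    open scoped MatrixOrder Matrix.Norms.L2Operator in
    exact CStarAlgebra.nonneg_iff_eq_star_mul_self.1 hpos.nonneg
  -- The conjugated rows of B, split as (p l, q l), are the vectors of the rank-one summands of Bᴴ
  -- B.
  set p : Fin L ⊕ Fin K → Fin L → ℂ := fun l i => star (B l (Sum.inl i)) with hp
  set q : Fin L ⊕ Fin K → Fin K → ℂ := fun l j => star (B l (Sum.inr j)) with hq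
  have h11 : (B.conjTranspose * B).toBlocks₁₁ = ∑ l, Matrix.vecMulVec (p l) (star (p l)) := by
    ext i j
    simp [Matrix.toBlocks₁₁, Matrix.mul_apply, Matrix.sum_apply, Matrix.vecMulVec_apply, hp]
  have h22 : (B.conjTranspose * B).toBlocks₂₂ = ∑ l, Matrix.vecMulVec (q l) (star (q l)) := by
    ext i j
    simp [Matrix.toBlocks₂₂, Matrix.mul_apply, Matrix.sum_apply, Matrix.vecMulVec_apply, hq]
  have h12 : (B.conjTranspose * B).toBlocks₁₂ = ∑ l, Matrix.vecMulVec (p l) (star (q l)) := by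
    ext i j
    simp [Matrix.toBlocks₁₂, Matrix.mul_apply, Matrix.sum_apply, Matrix.vecMulVec_apply, hp, hq]
  have h21 : (B.conjTranspose * B).toBlocks₂₁ = ∑ l, Matrix.vecMulVec (q l) (star (p l)) := by
    ext i j
    simp [Matrix.toBlocks₂₁, Matrix.mul_apply, Matrix.sum_apply, Matrix.vecMulVec_apply, hp, hq]
  rw [conjRev_seqConv, conjRev_conjRev] at hm
  simp only [measure, Prod.mk.injEq, h11, h22, h12, h21, trace_shiftMatrix_mul_sum] at hm
  obtain ⟨m11, m22, m12, m21⟩ := hm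
  have e11 := sum_zTransform_eq (p := p) (q := p) (P := x) (Q := x) le_rfl fun k => by
    rw [congrFun m11 k, autocorr, seqConv_apply]
  have e22 := sum_zTransform_eq (p := q) (q := q) (P := g) (Q := g) le_rfl fun k => by
    rw [congrFun m22 k, autocorr, seqConv_apply]
  have e12 := sum_zTransform_eq (p := p) (q := q) (P := x) (Q := g) le_rfl fun k => by
    rw [congrFun m12 k, seqConv_apply]
  have e21 := sum_zTransform_eq (p := q) (q := p) (P := g) (Q := x)
    (n := L + K - 1) (by omega) fun k => by
      rw [congrFun m21 k, seqConv_apply, mul_comm]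
  have hr : ∀ l, seqConv (p l) g - seqConv x (q l) = 0 := by
    refine eq_zero_of_sum_autocorr_eq_zero _ ?_
    simp only [conjRev_sub, zTransform_sub, conjRev_seqConv, zTransform_seqConv]
    have hexp : ∀ l, (zTransform (p l) * zTransform g - zTransform x * zTransform (q l)) *
        (zTransform (conjRev (p l)) * zTransform (conjRev g) -
          zTransform (conjRev x) * zTransform (conjRev (q l))) =
        (zTransform g * zTransform (conjRev g)) *
            (zTransform (p l) * zTransform (conjRev (p l))) -
          (zTransform g * zTransform (conjRev x)) *
            (zTransform (p l) * zTransform (conjRev (q l))) -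
          (zTransform x * zTransform (conjRev g)) *
            (zTransform (q l) * zTransform (conjRev (p l))) +
          (zTransform x * zTransform (conjRev x)) *
            (zTransform (q l) * zTransform (conjRev (q l))) := fun l => by ring
    -- After substituting the data, each of the four terms is ± X X~ G G~, with two signs of each
    -- kind.
    simp only [hexp, Finset.sum_add_distrib, Finset.sum_sub_distrib, ← Finset.mul_sum, e11, e22,
      e12, e21]
    ring
  have hcl : ∀ l, ∃ c : ℂ, p l = c • x ∧ q l = c • g := fun l => by
    refine exists_smul_of_mul_eq hx hc ?_
    rw [← zTransform_seqConv, ← zTransform_seqConv, sub_eq_zero.1 (hr l)]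
  choose c hcp hcq using hcl
  have hB : ∀ l a, B l a = star (c l * Sum.elim x g a) := by
    rintro l (i | j)
    · have := congrFun (hcp l) i
      simp only [hp, Pi.smul_apply, smul_eq_mul] at this
      rw [Sum.elim_inl, ← this, star_star]
    · have := congrFun (hcq l) j
      simp only [hq, Pi.smul_apply, smul_eq_mul] at this
      rw [Sum.elim_inr, ← this, star_star]
  have hZ : B.conjTranspose * B = (∑ l, c l * star (c l)) • rankOne (Sum.elim x g) := by
    ext a b
    simp only [Matrix.mul_apply, Matrix.conjTranspose_apply, hB, star_star, Matrix.smul_apply,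
      rankOne, Matrix.vecMulVec_apply, Pi.star_apply, smul_eq_mul, Finset.sum_mul, star_mul']
    exact Finset.sum_congr rfl fun l _ => by ring
  -- Compare central coefficients in `e11`: (∑ |c_l|²) ‖x‖² = ‖x‖² with x ≠ 0.
  have hsum : ∑ l, c l * star (c l) = 1 := by
    have h1 := coeff_zTransform_mul_conjRev_pred x
    have h2 := congrArg (fun P => P.coeff (L - 1)) e11
    simp only [finsetSum_coeff, coeff_zTransform_mul_conjRev_pred, hcp, Pi.smul_apply,
      smul_eq_mul, star_mul'] at h2
    have hne : ∑ i, x i * star (x i) ≠ 0 := by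
      rw [← h1, coeff_autocorr_center]
      obtain ⟨hL, hx0, -⟩ := hx
      have : norm2 x ≠ 0 := fun h0 => hx0 (congrFun (norm2_eq_zero.1 h0) _)
      exact_mod_cast pow_ne_zero 2 this
    refine mul_right_cancel₀ hne ?_
    rw [one_mul, Finset.sum_mul]
    refine (Finset.sum_congr rfl fun l _ => ?_).trans h2
    rw [Finset.mul_sum]
    exact Finset.sum_congr rfl fun i _ => by ring
  rw [hZ, hsum, one_smul]

/-- Two vectors define the same rank one matrix iff they agree up to a phase. -/
lemma rankOne_eq_rankOne_iff {ι : Type*} {v w : ι → ℂ} :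
    rankOne v = rankOne w ↔ ∃ φ : ℝ, v = Complex.exp (Complex.I * φ) • w := by
  constructor
  · intro hvw
    have key : ∀ a b, v a * star (v b) = w a * star (w b) := fun a b => by
      simpa [rankOne, Matrix.vecMulVec_apply] using congrFun (congrFun hvw a) b
    have hn : ∀ a, ‖v a‖ = ‖w a‖ := fun a => by
      have := key a a
      rw [mul_star_eq_normSq, mul_star_eq_normSq] at this
      have h2 : ‖v a‖ ^ 2 = ‖w a‖ ^ 2 := by exact_mod_cast this
      exact (sq_eq_sq₀ (norm_nonneg _) (norm_nonneg _)).1 h2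
    by_cases hw : ∃ b, w b ≠ 0
    · obtain ⟨b, hb⟩ := hw
      have hvb : v b ≠ 0 := norm_ne_zero_iff.1 (hn b ▸ norm_ne_zero_iff.2 hb)
      -- The ratio at an index with w b ≠ 0 is unimodular and serves for all indices.
      refine ⟨(v b / w b).arg, ?_⟩
      have hphase : Complex.exp (Complex.I * ((v b / w b).arg : ℝ)) = v b / w b := by
        have := Complex.norm_mul_exp_arg_mul_I (v b / w b)
        rwa [norm_div, hn b, div_self (norm_ne_zero_iff.2 hb), Complex.ofReal_one, one_mul,
          mul_comm] at this
      rw [hphase]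
      ext a
      have h1 := key a b
      have h2 := key b b
      have hsv : star (v b) ≠ 0 := star_ne_zero.2 hvb
      refine mul_right_cancel₀ hsv ?_
      rw [Pi.smul_apply, smul_eq_mul, h1, div_mul_eq_mul_div, div_mul_eq_mul_div,
        eq_div_iff hb]
      linear_combination -w a * h2
    · push Not at hw
      refine ⟨0, ?_⟩
      ext a
      have : v a = 0 := norm_eq_zero.1 (by rw [hn a, hw a, norm_zero])
      simp [this, hw a]
  · rintro ⟨φ, rfl⟩
    ext a b
    have h1 : Complex.exp (Complex.I * φ) * star (Complex.exp (Complex.I * φ)) = 1 := by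
      rw [mul_star_eq_normSq, mul_comm Complex.I, Complex.norm_exp_ofReal_mul_I]
      simp
    simp only [rankOne, Matrix.vecMulVec_apply, Pi.star_apply, Pi.smul_apply, smul_eq_mul,
      star_mul']
    linear_combination (w a * star (w b)) * h1

/-- Recovery up to a phase becomes exact after normalisation of the first coefficient. -/
lemma recovered_eq {L K : ℕ} (hL : 0 < L) {x : Fin L → ℂ} {h : Fin K → ℂ} {r : ℝ} (hr : 0 < r)
    (hx : x ⟨0, hL⟩ = (r : ℂ)) (φ : ℝ) :
    recoveredData hL (Complex.exp (Complex.I * φ) • Sum.elim x (conjRev h)) = x ∧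
      recoveredChannel hL (Complex.exp (Complex.I * φ) • Sum.elim x (conjRev h)) = h := by
  -- Since x_0 = r > 0 has trivial phase, the first entry shows exactly the unknown global phase.
  have hphase : firstPhase hL (Complex.exp (Complex.I * φ) • Sum.elim x (conjRev h)) =
      Complex.exp (Complex.I * φ) := by
    have hr' : (r : ℂ) ≠ 0 := by exact_mod_cast hr.ne'
    rw [firstPhase, Pi.smul_apply, Sum.elim_inl, hx, smul_eq_mul, norm_mul, mul_comm Complex.I,
      Complex.norm_exp_ofReal_mul_I, one_mul, Complex.norm_real, Real.norm_of_nonneg hr.le,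
      mul_div_assoc, div_self hr', mul_one]
  have hne := Complex.exp_ne_zero (Complex.I * φ)
  constructor
  · ext i
    rw [recoveredData, hphase, Pi.smul_apply, Sum.elim_inl, smul_eq_mul, mul_div_cancel_left₀ _ hne]
  · rw [recoveredChannel, hphase]
    simp only [Pi.smul_apply, Sum.elim_inr, smul_eq_mul, mul_div_cancel_left₀ _ hne]
    exact conjRev_conjRev h

lemma solvesSDP_received_iff {K M L : ℕ} (hK : 1 ≤ K) (hL : L = 2 * K + M) {h : Fin K → ℂ}
    (hh : EndsNonzero h) {E : ℝ} {x : Fin L → ℂ} (hx : IsHuffman E x)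
    (hc : IsCoprime (zTransform x) (zTransform (conjRev h)))
    (Z : Matrix (Fin L ⊕ Fin K) (Fin L ⊕ Fin K) ℂ) :
    SolvesSDP (receiverData K M L (seqConv x h)) Z ↔ Z = rankOne (Sum.elim x (conjRev h)) := by
  have hdata : receiverData K M L (seqConv x h) =
      (autocorr x, autocorr (conjRev h), seqConv x (conjRev (conjRev h)),
        conjRev (seqConv x (conjRev (conjRev h)))) := by
    -- The receiver knows a_h, while the program asks for the autocorrelation of the reversal; they
    -- agree because convolution commutes.
    have ha : autocorr (conjRev h) = autocorr h := by
      refine zTransform_injective ?_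
      rw [autocorr, autocorr, conjRev_conjRev, zTransform_seqConv, zTransform_seqConv, mul_comm]
    rw [receiverData_received hK hL hh hx, conjRev_conjRev, ha]
  rw [hdata]
  refine ⟨fun hZ => eq_rankOne_of_solvesSDP hx.1 hc hZ, ?_⟩
  rintro rfl
  exact solvesSDP_rankOne x (conjRev h)

lemma solvesSDP_received_rankOne_iff {K M L : ℕ} (hK : 1 ≤ K) (hL : L = 2 * K + M)
    {h : Fin K → ℂ} (hh : EndsNonzero h) {E : ℝ} {x : Fin L → ℂ} (hx : IsHuffman E x)
    (hc : IsCoprime (zTransform x) (zTransform (conjRev h))) (v : Fin L ⊕ Fin K → ℂ) :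
    SolvesSDP (receiverData K M L (seqConv x h)) (rankOne v) ↔
      ∃ φ : ℝ, v = Complex.exp (Complex.I * φ) • Sum.elim x (conjRev h) := by
  rw [solvesSDP_received_iff hK hL hh hx hc, rankOne_eq_rankOne_iff]

/-! ### Huffman codewords -/

section Radii

variable {L : ℕ} {E : ℝ}

lemma radius_base_mul (hE : 2 ≤ E) :
    (E / 2 + √(E ^ 2 / 4 - 1)) * (E / 2 - √(E ^ 2 / 4 - 1)) = 1 := by
  have := Real.sq_sqrt (show 0 ≤ E ^ 2 / 4 - 1 by nlinarith)
  linear_combination -this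

lemma radius_base_pos (hE : 2 ≤ E) : 0 < E / 2 + √(E ^ 2 / 4 - 1) := by
  have := Real.sqrt_nonneg (E ^ 2 / 4 - 1)
  linarith

lemma radius_base_pos' (hE : 2 ≤ E) : 0 < E / 2 - √(E ^ 2 / 4 - 1) :=
  pos_of_mul_pos_right (by rw [radius_base_mul hE]; exact one_pos) (radius_base_pos hE).le

lemma radiusPlus_pos (hE : 2 ≤ E) : 0 < radiusPlus L E :=
  Real.rpow_pos_of_pos (radius_base_pos hE) _

lemma radiusPlus_mul_radiusMinus (hE : 2 ≤ E) : radiusPlus L E * radiusMinus L E = 1 := by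
  rw [radiusPlus, radiusMinus,
    ← Real.mul_rpow (radius_base_pos hE).le (radius_base_pos' hE).le, radius_base_mul hE,
    Real.one_rpow]

lemma radiusMinus_eq_inv (hE : 2 ≤ E) : radiusMinus L E = (radiusPlus L E)⁻¹ :=
  eq_inv_of_mul_eq_one_right (radiusPlus_mul_radiusMinus hE)

lemma rpow_one_div_pred_pow (hL : 2 ≤ L) {a : ℝ} (ha : 0 ≤ a) :
    (a ^ (1 / ((L : ℝ) - 1))) ^ (L - 1) = a := by
  have h1 : ((L - 1 : ℕ) : ℝ) = (L : ℝ) - 1 := by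
    rw [Nat.cast_sub (by omega), Nat.cast_one]
  rw [one_div, ← h1]
  exact Real.rpow_inv_natCast_pow ha (by omega)

lemma radius_pow_add (hL : 2 ≤ L) (hE : 2 ≤ E) :
    radiusPlus L E ^ (L - 1) + radiusMinus L E ^ (L - 1) = E := by
  rw [radiusPlus, radiusMinus, rpow_one_div_pred_pow hL (radius_base_pos hE).le,
    rpow_one_div_pred_pow hL (radius_base_pos' hE).le]
  ring

/-- The modulus of the `k`-th root of the codeword polynomial. -/
noncomputable def codewordRadius (L : ℕ) (E : ℝ) (b : Fin (L - 1) → Bool) (k : Fin (L - 1)) : ℝ :=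
  if b k = true then radiusMinus L E else radiusPlus L E

/-- With R₋ = 1/R₊ the product is R₊ to the number of zero bits minus the number of one bits, which
explains the choice of c. -/
lemma prod_codewordRadius (hE : 2 ≤ E) (b : Fin (L - 1) → Bool) :
    ∏ k, codewordRadius L E b k = codewordScale L E b ^ 2 := by
  have hR := radiusPlus_pos (L := L) hE
  rw [codewordScale, Real.sq_sqrt (zpow_pos hR _).le, zpow_sub₀ hR.ne', zpow_natCast, zpow_natCast]
  simp only [codewordRadius, Finset.prod_ite, Finset.prod_const, radiusMinus_eq_inv hE,
    Bool.not_eq_true]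
  rw [inv_pow, mul_comm, div_eq_mul_inv]

lemma codewordScale_pos (hE : 2 ≤ E) (b : Fin (L - 1) → Bool) : 0 < codewordScale L E b :=
  Real.sqrt_pos.2 (zpow_pos (radiusPlus_pos hE) _)

end Radii

section Angles

variable {L : ℕ}

lemma huffmanAngle_mul_star (k : Fin (L - 1)) : huffmanAngle L k * star (huffmanAngle L k) = 1 := by
  have h1 : huffmanAngle L k =
      Complex.exp ((-(2 * Real.pi * (k : ℕ) / ((L : ℝ) - 1)) : ℝ) * Complex.I) := by
    rw [huffmanAngle]
    congr 1
    push_cast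
    ring
  rw [mul_star_eq_normSq, h1, Complex.norm_exp_ofReal_mul_I]
  simp

lemma star_huffmanAngle (hL : 2 ≤ L) (k : Fin (L - 1)) :
    star (huffmanAngle L k) =
      Complex.exp (2 * Real.pi * Complex.I / (L - 1 : ℕ)) ^ (k : ℕ) := by
  rw [huffmanAngle, Complex.star_def, ← Complex.exp_conj, ← Complex.exp_nat_mul,
    Nat.cast_sub (by omega)]
  congr 1
  simp only [map_neg, map_div₀, map_mul, map_sub, map_one, Complex.conj_I, Complex.conj_ofReal,
    map_natCast, map_ofNat]
  push_cast
  ring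

lemma prod_X_sub_star_huffmanAngle (hL : 2 ≤ L) (R : ℂ) :
    ∏ k : Fin (L - 1), (X - C (star (huffmanAngle L k) * R)) = X ^ (L - 1) - C (R ^ (L - 1)) := by
  rw [X_pow_sub_C_eq_prod (Complex.isPrimitiveRoot_exp (L - 1) (by omega)) (by omega) rfl,
    Finset.prod_range]
  exact Finset.prod_congr rfl fun k _ => by rw [star_huffmanAngle hL]

/-- Evaluate X^(L-1) - 1 and its factorisation at 0; the signs cancel for odd L - 1. -/
lemma prod_star_huffmanAngle (hL : 2 ≤ L) (hodd : Odd (L - 1)) :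
    ∏ k : Fin (L - 1), star (huffmanAngle L k) = 1 := by
  have h1 := congrArg (eval 0) (prod_X_sub_star_huffmanAngle hL 1)
  simp only [eval_prod, eval_sub, eval_X, eval_C, eval_pow, one_pow, mul_one, zero_sub,
    zero_pow (show L - 1 ≠ 0 by omega), Finset.prod_neg, Finset.card_univ, Fintype.card_fin,
    hodd.neg_one_pow, neg_mul, one_mul, neg_inj] at h1
  exact h1

lemma prod_huffmanAngle (hL : 2 ≤ L) (hodd : Odd (L - 1)) :
    ∏ k : Fin (L - 1), huffmanAngle L k = 1 := by
  have := congrArg star (prod_star_huffmanAngle hL hodd)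
  simpa only [star_prod, star_star, star_one] using this

end Angles

/-! ### Conjugate reversal as reflection of polynomials -/

lemma zTransform_conjRev {L : ℕ} (hL : 0 < L) (x : Fin L → ℂ) :
    zTransform (conjRev x) = reflect (L - 1) ((zTransform x).map (starRingEnd ℂ)) := by
  ext k
  rw [coeff_reflect, coeff_map, coeff_zTransform, coeff_zTransform]
  by_cases hk : k < L
  · rw [revAt_le (by omega), dif_pos hk, dif_pos (by omega), conjRev, Complex.star_def]
    congr 2
    ext
    rw [Fin.val_rev]
    change L - (k + 1) = L - 1 - k
    omega
  · rw [revAt_eq_self_of_lt (by omega), dif_neg hk, dif_neg hk, map_zero]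

lemma reflect_prod_X_sub_C {n : ℕ} (a : Fin n → ℂ) :
    reflect n (∏ k, (X - C (a k))) = ∏ k, (1 - C (a k) * X) := by
  induction n with
  | zero => simp
  | succ n ih =>
    have hdeg : (∏ k : Fin n, (X - C (a k.castSucc))).natDegree ≤ n := by
      rw [natDegree_prod_of_monic _ _ fun k _ => monic_X_sub_C _]
      simp
    rw [Fin.prod_univ_castSucc, reflect_mul _ _ hdeg (natDegree_X_sub_C_le _), ih,
      Fin.prod_univ_castSucc, reflect_sub, reflect_one_X, reflect_C, pow_one]

section Codeword

variable {L : ℕ} {E : ℝ}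

lemma codewordPoly_eq (b : Fin (L - 1) → Bool) :
    codewordPoly L E b = C (-((codewordScale L E b : ℂ))⁻¹) *
      ∏ k, (X - C (star (huffmanAngle L k) * (codewordRadius L E b k : ℂ))) := by
  rw [codewordPoly]
  congr 1
  refine Finset.prod_congr rfl fun k _ => ?_
  rw [codewordRadius]
  split_ifs <;>
    simp only [zetaMinus, zetaPlus, star_mul', Complex.star_def, Complex.conj_ofReal]

lemma zTransform_huffmanCodeword (hL : 2 ≤ L) (b : Fin (L - 1) → Bool) :
    zTransform (huffmanCodeword L E b) = codewordPoly L E b := by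
  refine zTransform_coeff_eq ?_
  refine lt_of_le_of_lt degree_le_natDegree ?_
  have h1 : (codewordPoly L E b).natDegree ≤ L - 1 := by
    rw [codewordPoly]
    refine (natDegree_C_mul_le _ _).trans ?_
    rw [natDegree_prod_of_monic _ _ fun k _ => monic_X_sub_C _]
    simp
  exact_mod_cast (by omega : (codewordPoly L E b).natDegree < L)

lemma zTransform_conjRev_huffmanCodeword (hL : 2 ≤ L) (b : Fin (L - 1) → Bool) :
    zTransform (conjRev (huffmanCodeword L E b)) = C (-((codewordScale L E b : ℂ))⁻¹) *
      ∏ k, (1 - C (huffmanAngle L k * (codewordRadius L E b k : ℂ)) * X) := by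
  rw [zTransform_conjRev (by omega), zTransform_huffmanCodeword hL, codewordPoly_eq,
    ← reflect_prod_X_sub_C, ← reflect_C_mul, Polynomial.map_mul, Polynomial.map_prod]
  simp only [Polynomial.map_sub, Polynomial.map_neg, Polynomial.map_X, Polynomial.map_C, map_neg, map_inv₀,
    map_mul (starRingEnd ℂ), Complex.conj_ofReal, Complex.star_def, Complex.conj_conj]

/-- For |t| = 1, 1 - t R X = -t R (X - conj t / R), and inversion exchanges R₊ and R₋. The bit
survives only in the constant. -/
lemma X_sub_C_mul_one_sub (hE : 2 ≤ E) (b : Fin (L - 1) → Bool) (k : Fin (L - 1)) :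
    (X - C (star (huffmanAngle L k) * (codewordRadius L E b k : ℂ))) *
        (1 - C (huffmanAngle L k * (codewordRadius L E b k : ℂ)) * X) =
      C (-(huffmanAngle L k * (codewordRadius L E b k : ℂ))) *
        ((X - C (star (huffmanAngle L k) * (radiusPlus L E : ℂ))) *
          (X - C (star (huffmanAngle L k) * (radiusMinus L E : ℂ)))) := by
  have h1 := congrArg (C : ℂ → ℂ[X]) (huffmanAngle_mul_star k)
  have h2 : (radiusPlus L E : ℂ) * (radiusMinus L E : ℂ) = 1 := by
    exact_mod_cast radiusPlus_mul_radiusMinus (L := L) hE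
  have h3 := congrArg (C : ℂ → ℂ[X]) h2
  simp only [C_mul, C_1] at h1 h3
  rw [codewordRadius]
  split_ifs <;> simp only [C_mul, C_neg]
  · generalize (C (huffmanAngle L k) : ℂ[X]) = t at *
    generalize (C (star (huffmanAngle L k)) : ℂ[X]) = s at *
    generalize (C (radiusPlus L E : ℂ) : ℂ[X]) = p at *
    generalize (C (radiusMinus L E : ℂ) : ℂ[X]) = m at *
    linear_combination (-p * m * X + s * p * m * m) * h1 + (-X + s * m) * h3
  · generalize (C (huffmanAngle L k) : ℂ[X]) = t at *
    generalize (C (star (huffmanAngle L k)) : ℂ[X]) = s at *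
    generalize (C (radiusPlus L E : ℂ) : ℂ[X]) = p at *
    generalize (C (radiusMinus L E : ℂ) : ℂ[X]) = m at *
    linear_combination (-p * m * X + s * p * p * m) * h1 + (-X + s * p) * h3

/-- The constant term is -c⁻¹ (-1)^(L-1) times the product of the roots, which is c²; evenness of L
makes the sign positive. -/
lemma coeff_zero_huffmanCodeword (hL : 2 ≤ L) (heven : Even L) (hE : 2 ≤ E)
    (b : Fin (L - 1) → Bool) :
    huffmanCodeword L E b ⟨0, by omega⟩ = (codewordScale L E b : ℂ) := by
  have hodd : Odd (L - 1) := Nat.Even.sub_odd (by omega) heven odd_one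
  have hc : (codewordScale L E b : ℂ) ≠ 0 := by exact_mod_cast (codewordScale_pos hE b).ne'
  have hprod : ∏ k, (codewordRadius L E b k : ℂ) = (codewordScale L E b : ℂ) ^ 2 := by
    exact_mod_cast prod_codewordRadius hE b
  rw [huffmanCodeword, codewordPoly_eq, coeff_zero_eq_eval_zero]
  simp only [eval_mul, eval_C, eval_prod, eval_sub, eval_X, zero_sub, Finset.prod_neg,
    Finset.card_univ, Fintype.card_fin, hodd.neg_one_pow, Finset.prod_mul_distrib,
    prod_star_huffmanAngle hL hodd, hprod]
  field_simp

lemma autocorr_huffmanCodeword (hL : 2 ≤ L) (heven : Even L) (hE : 2 ≤ E)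
    (b : Fin (L - 1) → Bool) : autocorr (huffmanCodeword L E b) = huffmanAutocorr L E := by
  have hodd : Odd (L - 1) := Nat.Even.sub_odd (by omega) heven odd_one
  have hc : (codewordScale L E b : ℂ) ≠ 0 := by exact_mod_cast (codewordScale_pos hE b).ne'
  have hprod : ∏ k, (codewordRadius L E b k : ℂ) = (codewordScale L E b : ℂ) ^ 2 := by
    exact_mod_cast prod_codewordRadius hE b
  have hconst : ∏ k, (C (-(huffmanAngle L k * (codewordRadius L E b k : ℂ))) : ℂ[X]) =
      C (-(codewordScale L E b : ℂ) ^ 2) := by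
    rw [← map_prod, Finset.prod_neg, Finset.prod_mul_distrib, prod_huffmanAngle hL hodd, hprod,
      Finset.card_univ, Fintype.card_fin, hodd.neg_one_pow]
    simp
  have hsum : (radiusPlus L E : ℂ) ^ (L - 1) + (radiusMinus L E : ℂ) ^ (L - 1) = E := by
    exact_mod_cast radius_pow_add hL hE
  have hmul : (radiusPlus L E : ℂ) ^ (L - 1) * (radiusMinus L E : ℂ) ^ (L - 1) = 1 := by
    rw [← mul_pow]
    exact_mod_cast by rw [radiusPlus_mul_radiusMinus hE, one_pow]
  -- The choice of c normalises the outer autocorrelation coefficients to -1.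
  have hscale : (C (-((codewordScale L E b : ℂ))⁻¹) * C (-((codewordScale L E b : ℂ))⁻¹) *
      C (-(codewordScale L E b : ℂ) ^ 2) : ℂ[X]) = -1 := by
    rw [← C_mul, ← C_mul, ← C_1, ← C_neg]
    congr 1
    field_simp
  refine zTransform_injective ?_
  rw [zTransform_huffmanAutocorr hL, autocorr, zTransform_seqConv,
    zTransform_conjRev_huffmanCodeword hL, zTransform_huffmanCodeword hL, codewordPoly_eq,
    mul_mul_mul_comm, ← Finset.prod_mul_distrib]
  simp only [X_sub_C_mul_one_sub hE]
  rw [Finset.prod_mul_distrib, Finset.prod_mul_distrib, hconst, prod_X_sub_star_huffmanAngle hL,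
    prod_X_sub_star_huffmanAngle hL, ← mul_assoc, hscale]
  have h1 := congrArg (C : ℂ → ℂ[X]) hsum
  have h2 := congrArg (C : ℂ → ℂ[X]) hmul
  rw [C_add] at h1
  rw [C_mul, C_1] at h2
  rw [two_mul, pow_add]
  linear_combination X ^ (L - 1) * h1 - h2

lemma isHuffman_huffmanCodeword (hL : 2 ≤ L) (heven : Even L) (hE : 2 ≤ E)
    (b : Fin (L - 1) → Bool) : IsHuffman E (huffmanCodeword L E b) := by
  have ha := autocorr_huffmanCodeword hL heven hE b
  refine ⟨⟨by omega, ?_, ?_⟩, ha⟩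
  · rw [coeff_zero_huffmanCodeword hL heven hE]
    exact_mod_cast (codewordScale_pos hE b).ne'
  -- The product of the L - 1 linear factors is monic, so the last coefficient is -c⁻¹.
  · intro h0
    have hc : (codewordScale L E b : ℂ) ≠ 0 := by exact_mod_cast (codewordScale_pos hE b).ne'
    have h1 : (codewordPoly L E b).coeff (L - 1) = 0 := h0
    have hmonic : (∏ k, (X - C (star (huffmanAngle L k) *
        (codewordRadius L E b k : ℂ)))).coeff (L - 1) = 1 := by
      have hm := monic_prod_of_monic Finset.univ
        (fun k => X - C (star (huffmanAngle L k) * (codewordRadius L E b k : ℂ)))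
        fun k _ => monic_X_sub_C _
      have hd : (∏ k, (X - C (star (huffmanAngle L k) *
          (codewordRadius L E b k : ℂ)))).natDegree = L - 1 := by
        rw [natDegree_prod_of_monic _ _ fun k _ => monic_X_sub_C _]
        simp only [natDegree_X_sub_C]
        simp
      rw [← hm.coeff_natDegree, hd]
    rw [codewordPoly_eq, coeff_C_mul, hmonic, mul_one, neg_eq_zero, inv_eq_zero] at h1
    exact hc h1

end Codeword

end HuffmanBlind

theorem mainTheorem1 (K M L : ℕ) (hK : 1 ≤ K) (hL : L = 2 * K + M)
    (h : Fin K → ℂ) (hh : EndsNonzero h) :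
    -- recovery for an arbitrary Huffman sequence
    (∀ (E : ℝ) (x : Fin L → ℂ), IsHuffman E x →
      -- splitting of the autocorrelation of the received signal
      List.ofFn (autocorr (seqConv x h)) =
          List.ofFn (-autocorr h) ++ List.replicate M 0 ++
          List.ofFn ((E : ℂ) • autocorr h) ++ List.replicate M 0 ++
          List.ofFn (-autocorr h) ∧
      -- channel autocorrelation and energy are read off exactly
      channelAutocorrEst K (seqConv x h) = autocorr h ∧
      norm2 (firstBlock K (seqConv x h)) ≠ 0 ∧
      energyEst K M (seqConv x h) = E ∧
      E = norm2 x ^ 2 ∧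
      huffmanAutocorr L (energyEst K M (seqConv x h)) = autocorr x ∧
      (IsCoprime (zTransform x) (zTransform (conjRev h)) →
        -- the program has exactly one solution
        (∀ Z : Matrix (Fin L ⊕ Fin K) (Fin L ⊕ Fin K) ℂ,
          SolvesSDP (receiverData K M L (seqConv x h)) Z ↔
            Z = rankOne (Sum.elim x (conjRev h))) ∧
        -- which determines the data and the channel up to a global phase
        (∀ v : Fin L ⊕ Fin K → ℂ,
          SolvesSDP (receiverData K M L (seqConv x h)) (rankOne v) ↔
            ∃ φ : ℝ, v = Complex.exp (Complex.I * φ) • Sum.elim x (conjRev h)) ∧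
        -- and exactly, if the first coefficient of the data is positive
        ((∃ r : ℝ, 0 < r ∧ x ⟨0, by omega⟩ = (r : ℂ)) →
          ∀ v : Fin L ⊕ Fin K → ℂ,
            SolvesSDP (receiverData K M L (seqConv x h)) (rankOne v) →
              recoveredData (by omega) v = x ∧ recoveredChannel (by omega) v = h))) ∧
    -- for even length the Huffman codewords have a positive first coefficient, and are recovered
    (Even L → ∀ (E : ℝ), 2 ≤ E → ∀ b : Fin (L - 1) → Bool,
      IsHuffman E (huffmanCodeword L E b) ∧
      (∃ r : ℝ, 0 < r ∧ huffmanCodeword L E b ⟨0, by omega⟩ = (r : ℂ)) ∧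
      (IsCoprime (zTransform (huffmanCodeword L E b)) (zTransform (conjRev h)) →
        ∀ v : Fin L ⊕ Fin K → ℂ,
          SolvesSDP (receiverData K M L (seqConv (huffmanCodeword L E b) h)) (rankOne v) →
            recoveredData (by omega) v = huffmanCodeword L E b ∧
              recoveredChannel (by omega) v = h)) := by
  refine ⟨fun E x hx => ⟨autocorr_received_eq hK hL h hx, ?_, ?_, energyEst_received hK hL hh hx,
    energy_eq_norm2_sq (by omega) hx, ?_, fun hc => ⟨solvesSDP_received_iff hK hL hh hx hc,
      solvesSDP_received_rankOne_iff hK hL hh hx hc, ?_⟩⟩, fun heven E hE b => ?_⟩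
  · rw [channelAutocorrEst, firstBlock_received hK hL h hx, neg_neg]
  · rw [firstBlock_received hK hL h hx, norm2_neg]
    exact norm2_autocorr_ne_zero hh
  · rw [energyEst_received hK hL hh hx, hx.2]
  · rintro ⟨r, hr, hxr⟩ v hv
    obtain ⟨φ, rfl⟩ := (solvesSDP_received_rankOne_iff hK hL hh hx hc v).1 hv
    exact recovered_eq _ hr hxr φ
  · have hx := isHuffman_huffmanCodeword (by omega) heven hE b
    have hx0 := coeff_zero_huffmanCodeword (by omega) heven hE b
    have hpos := codewordScale_pos hE b
    refine ⟨hx, ⟨_, hpos, hx0⟩, fun hc v hv => ?_⟩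
    obtain ⟨φ, rfl⟩ := (solvesSDP_received_rankOne_iff hK hL hh hx hc v).1 hv
    exact recovered_eq _ hpos hx0 φ
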